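/- There is an absolute constant $C>0$ such that the following holds. Let $m\ge 1$, let $X=(X_1,\dots,X_m)$ be a random vector in $\mathbb{R}^m$ with independent components satisfying $\mathbb{E}X_i=0$, $\mathbb{E}X_i^2=1$ and $\|X_i\|_{\psi_2}:=\sup_{q\ge 1}q^{-1/2}(\mathbb{E}|X_i|^q)^{1/q}\le K$ for all $i$. Let $\xi=(\xi_1,\dots,\xi_m)\in\{0,1\}^m$ be a random vector independent of $X$, with independent Bernoulli components satisfying $\mathbb{E}\xi_i=p_i$, and let $D_\xi=\mathrm{diag}(\xi_1,\dots,\xi_m)$. Let $D_0=[d_1,\dots,d_m]$ be a symmetric real $m\times m$ matrix with columns $d_1,\dots,d_m$. Then, with probability at least $1-4/m^4$, $$ |X^{T}D_0D_\xi D_0X|\;\le\;\sum_{i=1}^m p_i\|d_i\|_2^2+CK^2\,(\log m)^{1/2}\,\|D_0\|_2\Big((\log m)^{1/2}\|D_0\|_2+2\big(\max_{1\le i\le m}\|d_i\|_2\big)\|\mathbf{p}\|_1^{1/2}\Big), $$ where $\|D_0\|_2$ is the operator norm of $D_0$, $\|d_i\|_2$ is the Euclidean norm of $d_i$, and $\|\mathbf{p}\|_1=\sum_{i=1}^m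 p_i$. -/

import Mathlib

open MeasureTheory ProbabilityTheory
open scoped ENNReal Matrix

/-- The sub-gaussian norm `‖X‖_{ψ₂} = sup_{q ≥ 1} q^{-1/2} (𝔼 |X|^q)^{1/q}` of a random variable,
as an extended nonnegative real (the value is `∞` when `X` is not sub-gaussian). -/
noncomputable def psiTwoNorm {Ω : Type*} [MeasurableSpace Ω] (X : Ω → ℝ) (μ : Measure Ω) : ℝ≥0∞ :=
  ⨆ (q : ℝ) (_ : 1 ≤ q), ENNReal.ofReal (q ^ (-(1 / 2) : ℝ)) * eLpNorm X (ENNReal.ofReal q) μ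

/-- The operator norm `‖A‖₂` of a square real matrix acting on Euclidean space. -/
noncomputable def matOpNorm {m : ℕ} (A : Matrix (Fin m) (Fin m) ℝ) : ℝ :=
  ‖Matrix.toEuclideanCLM (n := Fin m) (𝕜 := ℝ) A‖

/-- The Euclidean norm `‖v‖₂` of a vector in `ℝᵐ`. -/
noncomputable def vecNormTwo {m : ℕ} (v : Fin m → ℝ) : ℝ :=
  ‖(WithLp.toLp 2 v : EuclideanSpace ℝ (Fin m))‖

/-! ### One-variable moment generating functions: sub-gaussian, its square, Gaussian. -/

section OneDimensional

variable {Ω : Type*} [MeasurableSpace Ω] {μ : Measure Ω} {X : Ω → ℝ} {K : ℝ}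

/-! The form is almost surely nonnegative, since `ξ` selects coordinates, so only an upper tail is
needed, and a Chernoff bound gives it. Fix `ξ = e` and put `A = D * diagonal e * D`. Then `A` is
positive semidefinite, has operator norm at most `‖D‖²`, trace `∑ e_k ‖d_k‖²`, and squared Frobenius
norm at most `‖D‖²` times its trace.

A Hanson-Wright estimate (`lintegral_exp_quadForm_le`) bounds the exponential moment in `X` by `exp
(t tr A + c K⁴ t² ‖A‖_F²)`. By the Frobenius bound (`Matrix.IsSymm.sum_compression_sq_le`) this is
at most the exponential of a linear form in `e`, which independent Bernoulli variables integrate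
exactly. The result is `lintegral_exp_sparse_quadForm_le`; optimising `t` finishes.

First-order terms are kept sharp throughout, so that `∑ p_i ‖d_i‖²` appears with coefficient one. In
Hanson-Wright the diagonal uses `𝔼 X_i² = 1`. The off-diagonal part is decoupled over random subsets
of the coordinates; one half is integrated as a linear form, and the remaining squared norm is
linearised by an auxiliary Gaussian vector. -/

lemma lintegral_even_pow_le_of_psiTwoNorm_le (hK : psiTwoNorm X μ ≤ ENNReal.ofReal K)
    {n : ℕ} (hn : n ≠ 0) :
    ∫⁻ ω, ENNReal.ofReal (X ω ^ (2 * n)) ∂μ ≤ ENNReal.ofReal ((2 * n * K ^ 2) ^ n) := by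
  have hq1 : (1 : ℝ) ≤ ((2 * n : ℕ) : ℝ) := by
    have : 1 ≤ 2 * n := by omega
    exact_mod_cast this
  have hq0 : (0 : ℝ) < ((2 * n : ℕ) : ℝ) := by linarith
  have h := (le_iSup₂_of_le (f := fun (q : ℝ) (_ : 1 ≤ q) =>
    ENNReal.ofReal (q ^ (-(1 / 2) : ℝ)) * eLpNorm X (ENNReal.ofReal q) μ)
    ((2 * n : ℕ) : ℝ) hq1 le_rfl).trans hK
  have h2 := pow_le_pow_left' h (2 * n)
  rw [mul_pow] at h2
  have e1 : eLpNorm X (ENNReal.ofReal ((2 * n : ℕ) : ℝ)) μ ^ (2 * n)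
      = ∫⁻ ω, ENNReal.ofReal (X ω ^ (2 * n)) ∂μ := by
    have := eLpNorm_nnreal_pow_eq_lintegral (μ := μ) (f := X) (p := ((2 * n : ℕ) : NNReal))
      (by exact_mod_cast (by omega : 2 * n ≠ 0))
    rw [show ((((2 * n : ℕ) : NNReal) : ℝ≥0∞)) = ENNReal.ofReal ((2 * n : ℕ) : ℝ) by simp] at this
    rw [show (((2 * n : ℕ) : NNReal) : ℝ) = ((2 * n : ℕ) : ℝ) by simp, ENNReal.rpow_natCast] at this
    rw [this]
    refine lintegral_congr fun ω => ?_
    rw [ENNReal.rpow_natCast, Real.enorm_eq_ofReal_abs, ← ENNReal.ofReal_pow (abs_nonneg _),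
      pow_mul, sq_abs, ← pow_mul]
  have e2 : (((2 * n : ℕ) : ℝ) ^ (-(1 / 2) : ℝ)) ^ (2 * n) = (((2 * n : ℕ) : ℝ) ^ n)⁻¹ := by
    rw [← Real.rpow_natCast, ← Real.rpow_mul hq0.le, ← Real.rpow_natCast, ← Real.rpow_neg hq0.le]
    congr 1
    push_cast
    ring
  rw [e1, ← ENNReal.ofReal_pow (Real.rpow_nonneg hq0.le _), e2,
    ENNReal.ofReal_inv_of_pos (by positivity)] at h2
  rw [mul_comm, ← div_eq_mul_inv] at h2
  have h3 := (ENNReal.div_le_iff (by simp [hn]) ENNReal.ofReal_ne_top).1 h2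
  refine h3.trans ?_
  rcases le_total 0 K with hK0 | hK0
  · rw [← ENNReal.ofReal_pow hK0, ← ENNReal.ofReal_mul (by positivity)]
    apply ENNReal.ofReal_le_ofReal
    rw [pow_mul, ← mul_pow]
    push_cast
    rw [mul_comm]
  · rw [ENNReal.ofReal_of_nonpos hK0, zero_pow (by omega)]
    simp

/-- The exponent `q = 2` in the sub-gaussian norm. It lets terms without a factor `K ^ 2` be
absorbed into terms with one. -/
lemma half_le_sq_of_psiTwoNorm_le (hX2 : ∫ ω, X ω ^ 2 ∂μ = 1)
    (hK : psiTwoNorm X μ ≤ ENNReal.ofReal K) : 1 ≤ 2 * K ^ 2 := by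
  have h := lintegral_even_pow_le_of_psiTwoNorm_le hK one_ne_zero
  have hint : Integrable (fun ω => X ω ^ 2) μ := by
    by_contra hc
    rw [integral_undef hc] at hX2
    norm_num at hX2
  rw [mul_one, ← ofReal_integral_eq_lintegral_ofReal hint (ae_of_all _ fun _ => sq_nonneg _),
    hX2, ENNReal.ofReal_le_ofReal_iff (by positivity)] at h
  simpa using h

lemma pow_self_le_three_pow_mul_factorial (n : ℕ) : (n : ℝ) ^ n ≤ 3 ^ n * n.factorial := by
  have h := Real.pow_div_factorial_le_exp (n : ℝ) (by positivity) n
  rw [div_le_iff₀ (by positivity)] at h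
  refine h.trans ?_
  gcongr
  rw [← Real.exp_one_pow]
  gcongr
  exact Real.exp_one_lt_d9.le.trans (by norm_num)

/-- The square of a sub-gaussian variable with unit second moment has a sub-exponential
moment generating function, with the exact first order term. -/
lemma lintegral_exp_mul_sq_le [IsProbabilityMeasure μ] (hX : Measurable X)
    (hX2 : ∫ ω, X ω ^ 2 ∂μ = 1) (hK : psiTwoNorm X μ ≤ ENNReal.ofReal K)
    {a : ℝ} (ha : 0 ≤ a) (haK : 12 * a * K ^ 2 ≤ 1) :
    ∫⁻ ω, ENNReal.ofReal (Real.exp (a * X ω ^ 2)) ∂μ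
      ≤ ENNReal.ofReal (Real.exp (a + 72 * K ^ 4 * a ^ 2)) := by
  -- Ratio of the dominating geometric series: the `n`-th exponential term is at most `(2aK²)^n n^n
  -- / n! ≤ (6aK²)^n`. Its tail from `n = 2` is at most `2r² = 72K⁴a²`.
  set r : ℝ := 6 * a * K ^ 2 with hr
  have hr0 : 0 ≤ r := by positivity
  have hr1 : r ≤ 1 / 2 := by rw [hr]; linarith
  have hint : Integrable (fun ω => X ω ^ 2) μ := by
    by_contra hc
    rw [integral_undef hc] at hX2
    norm_num at hX2
  have hexp : ∀ ω, ENNReal.ofReal (Real.exp (a * X ω ^ 2))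
      = ∑' n : ℕ, ENNReal.ofReal ((a * X ω ^ 2) ^ n / n.factorial) := by
    intro ω
    rw [Real.exp_eq_exp_ℝ, NormedSpace.exp_eq_tsum_div,
      ENNReal.ofReal_tsum_of_nonneg (fun n => by positivity)
        (NormedSpace.expSeries_div_summable _)]
  simp_rw [hexp]
  rw [lintegral_tsum (fun n => by fun_prop)]
  -- The terms of order 0 and 1 are evaluated exactly, as `1 + a`; only the rest is estimated.
  rw [← Summable.sum_add_tsum_nat_add' (k := 2) ENNReal.summable]
  have h0 : ∑ i ∈ Finset.range 2,
      ∫⁻ ω, ENNReal.ofReal ((a * X ω ^ 2) ^ i / i.factorial) ∂μ = ENNReal.ofReal (1 + a) := by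
    rw [Finset.sum_range_succ, Finset.sum_range_one]
    have : ∫⁻ ω, ENNReal.ofReal ((a * X ω ^ 2) ^ 1 / Nat.factorial 1) ∂μ = ENNReal.ofReal a := by
      rw [← ofReal_integral_eq_lintegral_ofReal (by simpa using hint.const_mul a)
        (ae_of_all _ fun _ => by positivity)]
      simp [integral_const_mul, hX2]
    rw [this]
    simp only [pow_zero, Nat.factorial_zero, Nat.cast_one, div_one, lintegral_const, measure_univ,
      mul_one]
    rw [← ENNReal.ofReal_add zero_le_one ha]
  have hn : ∀ n : ℕ, ∫⁻ ω, ENNReal.ofReal ((a * X ω ^ 2) ^ (n + 2) / (n + 2).factorial) ∂μ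
      ≤ ENNReal.ofReal (r ^ 2 * r ^ n) := by
    intro n
    have : ∀ ω, ENNReal.ofReal ((a * X ω ^ 2) ^ (n + 2) / (n + 2).factorial)
        = ENNReal.ofReal (a ^ (n + 2) / (n + 2).factorial)
          * ENNReal.ofReal (X ω ^ (2 * (n + 2))) := by
      intro ω
      rw [← ENNReal.ofReal_mul (by positivity), mul_pow, ← pow_mul]
      congr 1
      ring
    simp_rw [this]
    rw [lintegral_const_mul _ (by fun_prop)]
    refine (mul_le_mul_right (lintegral_even_pow_le_of_psiTwoNorm_le hK (by omega)) _).trans ?_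
    rw [← ENNReal.ofReal_mul (by positivity)]
    apply ENNReal.ofReal_le_ofReal
    have h3 := pow_self_le_three_pow_mul_factorial (n + 2)
    calc a ^ (n + 2) / (n + 2).factorial * (2 * ((n + 2 : ℕ) : ℝ) * K ^ 2) ^ (n + 2)
        = (2 * a * K ^ 2) ^ (n + 2) * (((n + 2 : ℕ) : ℝ) ^ (n + 2) / (n + 2).factorial) := by
          rw [mul_pow, mul_pow, mul_pow, mul_pow]; ring
      _ ≤ (2 * a * K ^ 2) ^ (n + 2) * 3 ^ (n + 2) := by
          gcongr
          rwa [div_le_iff₀ (by positivity)]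
      _ = r ^ 2 * r ^ n := by
          rw [← mul_pow, ← pow_add, add_comm 2 n, hr]; ring
  rw [h0]
  have hgeo : ∑' n : ℕ, ENNReal.ofReal (r ^ 2 * r ^ n) ≤ ENNReal.ofReal (2 * r ^ 2) := by
    have hs : Summable fun n : ℕ => r ^ 2 * r ^ n :=
      (summable_geometric_of_lt_one hr0 (by linarith)).mul_left _
    rw [← ENNReal.ofReal_tsum_of_nonneg (fun n => by positivity) hs, tsum_mul_left,
      tsum_geometric_of_lt_one hr0 (by linarith)]
    apply ENNReal.ofReal_le_ofReal
    have : (1 - r)⁻¹ ≤ 2 := by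
      rw [inv_le_comm₀ (by linarith) (by norm_num)]
      linarith
    nlinarith [sq_nonneg r]
  calc _ ≤ ENNReal.ofReal (1 + a) + ENNReal.ofReal (2 * r ^ 2) := by
        gcongr
        exact (ENNReal.tsum_le_tsum hn).trans hgeo
    _ = ENNReal.ofReal (1 + a + 2 * r ^ 2) := by
        rw [← ENNReal.ofReal_add (by positivity) (by positivity)]
    _ ≤ _ := by
        apply ENNReal.ofReal_le_ofReal
        have := Real.add_one_le_exp (a + 72 * K ^ 4 * a ^ 2)
        rw [hr]
        nlinarith

/-- The linear term integrates to zero for a centered variable, which reduces its exponential moment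
to that of its square. -/
lemma Real.exp_le_add_exp_sq (x : ℝ) : Real.exp x ≤ x + Real.exp (x ^ 2) := by
  have h := Real.add_one_le_exp (x ^ 2)
  rcases le_total |x| 1 with h1 | h1
  · have := (abs_le.1 (Real.abs_exp_sub_one_sub_id_le h1)).2
    linarith
  · rcases le_total 0 x with h2 | h2
    · rw [abs_of_nonneg h2] at h1
      have : Real.exp x ≤ Real.exp (x ^ 2) := Real.exp_le_exp.2 (by nlinarith)
      linarith
    · rw [abs_of_nonpos h2] at h1
      have : Real.exp x ≤ 1 := Real.exp_le_one_iff.2 h2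
      nlinarith

/-- A centered sub-gaussian variable has a sub-gaussian moment generating function. -/
lemma lintegral_exp_mul_le [IsProbabilityMeasure μ] (hX : Measurable X)
    (hX1 : ∫ ω, X ω ∂μ = 0) (hX2 : ∫ ω, X ω ^ 2 ∂μ = 1)
    (hK : psiTwoNorm X μ ≤ ENNReal.ofReal K) (s : ℝ) :
    ∫⁻ ω, ENNReal.ofReal (Real.exp (s * X ω)) ∂μ
      ≤ ENNReal.ofReal (Real.exp (11 * K ^ 2 * s ^ 2)) := by
  have hK2 := half_le_sq_of_psiTwoNorm_le hX2 hK
  have hint : Integrable (fun ω => X ω ^ 2) μ := by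
    by_contra hc
    rw [integral_undef hc] at hX2
    norm_num at hX2
  have hintX : Integrable X μ :=
    ((memLp_two_iff_integrable_sq hX.aestronglyMeasurable).2 hint).integrable (by norm_num)
  -- For small `s` the square's bound applies with `a = s²`. For large `s`, completing the square
  -- costs `3K²s²`, and the leftover constant `1/6 + 1/2` is at most `8K²s²`; this is where 11 comes
  -- from.
  rcases le_total (12 * s ^ 2 * K ^ 2) 1 with hs | hs
  · have h := lintegral_exp_mul_sq_le hX hX2 hK (sq_nonneg s) hs
    have hI : Integrable (fun ω => Real.exp (s ^ 2 * X ω ^ 2)) μ := by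
      refine ⟨by fun_prop, ?_⟩
      rw [hasFiniteIntegral_iff_ofReal (ae_of_all _ fun _ => (Real.exp_pos _).le)]
      exact h.trans_lt ENNReal.ofReal_lt_top
    have hle : ∀ ω, Real.exp (s * X ω) ≤ s * X ω + Real.exp (s ^ 2 * X ω ^ 2) := fun ω => by
      simpa [mul_pow] using Real.exp_le_add_exp_sq (s * X ω)
    have hJ : Integrable (fun ω => s * X ω + Real.exp (s ^ 2 * X ω ^ 2)) μ :=
      (hintX.const_mul s).add hI
    calc ∫⁻ ω, ENNReal.ofReal (Real.exp (s * X ω)) ∂μ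
        ≤ ∫⁻ ω, ENNReal.ofReal (s * X ω + Real.exp (s ^ 2 * X ω ^ 2)) ∂μ :=
          lintegral_mono fun ω => ENNReal.ofReal_le_ofReal (hle ω)
      _ = ENNReal.ofReal (∫ ω, Real.exp (s ^ 2 * X ω ^ 2) ∂μ) := by
          rw [← ofReal_integral_eq_lintegral_ofReal hJ
            (ae_of_all _ fun ω => (Real.exp_pos _).le.trans (hle ω)),
            integral_add (hintX.const_mul s) hI, integral_const_mul, hX1, mul_zero, zero_add]
      _ = ∫⁻ ω, ENNReal.ofReal (Real.exp (s ^ 2 * X ω ^ 2)) ∂μ :=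
          ofReal_integral_eq_lintegral_ofReal hI (ae_of_all _ fun _ => (Real.exp_pos _).le)
      _ ≤ _ := h
      _ ≤ _ := by
          apply ENNReal.ofReal_le_ofReal
          apply Real.exp_le_exp.2
          have h1 : K ^ 2 * s ^ 2 * (12 * s ^ 2 * K ^ 2) ≤ K ^ 2 * s ^ 2 * 1 := by gcongr
          nlinarith [sq_nonneg s, mul_nonneg (sq_nonneg K) (sq_nonneg s)]
  · have hKpos : 0 < K ^ 2 := by linarith
    have hK0 : K ≠ 0 := fun h => by simp [h] at hKpos
    have h := lintegral_exp_mul_sq_le hX hX2 hK (a := 1 / (12 * K ^ 2)) (by positivity)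
      (by field_simp; norm_num)
    have hle : ∀ ω, Real.exp (s * X ω)
        ≤ Real.exp (3 * K ^ 2 * s ^ 2) * Real.exp (1 / (12 * K ^ 2) * X ω ^ 2) := fun ω => by
      rw [← Real.exp_add]
      apply Real.exp_le_exp.2
      have : 3 * K ^ 2 * s ^ 2 + 1 / (12 * K ^ 2) * X ω ^ 2 - s * X ω
        = 1 / (12 * K ^ 2) * (6 * K ^ 2 * s - X ω) ^ 2 := by field_simp; ring
      have h2 : 0 ≤ 1 / (12 * K ^ 2) * (6 * K ^ 2 * s - X ω) ^ 2 := by positivity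
      linarith
    calc ∫⁻ ω, ENNReal.ofReal (Real.exp (s * X ω)) ∂μ
        ≤ ∫⁻ ω, ENNReal.ofReal (Real.exp (3 * K ^ 2 * s ^ 2))
            * ENNReal.ofReal (Real.exp (1 / (12 * K ^ 2) * X ω ^ 2)) ∂μ :=
          lintegral_mono fun ω => by
            rw [← ENNReal.ofReal_mul (Real.exp_pos _).le]
            exact ENNReal.ofReal_le_ofReal (hle ω)
      _ = ENNReal.ofReal (Real.exp (3 * K ^ 2 * s ^ 2))
            * ∫⁻ ω, ENNReal.ofReal (Real.exp (1 / (12 * K ^ 2) * X ω ^ 2)) ∂μ :=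
          lintegral_const_mul _ (by fun_prop)
      _ ≤ _ := mul_le_mul_right h _
      _ ≤ _ := by
          rw [← ENNReal.ofReal_mul (Real.exp_pos _).le, ← Real.exp_add]
          apply ENNReal.ofReal_le_ofReal
          apply Real.exp_le_exp.2
          have e1 : 72 * K ^ 4 * (1 / (12 * K ^ 2)) ^ 2 = 1 / 2 := by field_simp; norm_num
          have e2 : 1 / (12 * K ^ 2) ≤ 1 / 6 := by
            apply one_div_le_one_div_of_le <;> linarith
          rw [e1]
          linarith

lemma lintegral_exp_mul_gaussianReal (b : ℝ) :
    ∫⁻ z, ENNReal.ofReal (Real.exp (b * z)) ∂(gaussianReal 0 1)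
      = ENNReal.ofReal (Real.exp (b ^ 2 / 2)) := by
  rw [← ofReal_integral_eq_lintegral_ofReal (integrable_exp_mul_gaussianReal b)
    (ae_of_all _ fun _ => (Real.exp_pos _).le)]
  have := congrFun (mgf_id_gaussianReal (μ := 0) (v := 1)) b
  simp only [mgf, id] at this
  rw [this]
  simp

/-- The integral is `(1 - 2t)^(-1/2)`, and `(1 + 4t)(1 - 2t) ≥ 1` exactly on `0 ≤ t ≤ 1/4`. -/
lemma lintegral_exp_mul_sq_gaussianReal_le {t : ℝ} (ht0 : 0 ≤ t) (ht : t ≤ 1 / 4) :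
    ∫⁻ z, ENNReal.ofReal (Real.exp (t * z ^ 2)) ∂(gaussianReal 0 1)
      ≤ ENNReal.ofReal (Real.exp (2 * t)) := by
  have hb : 0 < 1 / 2 - t := by linarith
  rw [gaussianReal_of_var_ne_zero _ one_ne_zero,
    lintegral_withDensity_eq_lintegral_mul _ (by fun_prop) (by fun_prop)]
  have : ∀ z : ℝ, (gaussianPDF 0 1 * fun z => ENNReal.ofReal (Real.exp (t * z ^ 2))) z
      = ENNReal.ofReal ((√(2 * Real.pi))⁻¹ * Real.exp (-(1 / 2 - t) * z ^ 2)) := by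
    intro z
    rw [Pi.mul_apply, gaussianPDF, ← ENNReal.ofReal_mul (gaussianPDFReal_nonneg _ _ _),
      gaussianPDFReal, mul_assoc, ← Real.exp_add]
    congr 3
    · simp
    · simp; ring
  simp_rw [this]
  rw [← ofReal_integral_eq_lintegral_ofReal ((integrable_exp_neg_mul_sq hb).const_mul _)
    (ae_of_all _ fun _ => by positivity), integral_const_mul, integral_gaussian]
  apply ENNReal.ofReal_le_ofReal
  rw [← Real.sqrt_inv, ← Real.sqrt_mul (by positivity)]
  apply Real.sqrt_le_iff.2 ⟨(Real.exp_pos _).le, ?_⟩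
  rw [← Real.exp_nat_mul]
  have h1 : (2 * Real.pi)⁻¹ * (Real.pi / (1 / 2 - t)) = 1 / (1 - 2 * t) := by
    have : 1 - 2 * t ≠ 0 := by linarith
    have := Real.pi_ne_zero
    field_simp
  rw [h1, div_le_iff₀ (by linarith)]
  have := Real.add_one_le_exp ((2 : ℕ) * (2 * t))
  push_cast at *
  nlinarith

end OneDimensional

/-! ### Product measures: squared norms of linear images, and decoupling. -/

section ProductMeasure

variable {ι : Type*} [Fintype ι] {ν : ι → Measure ℝ} [∀ i, IsProbabilityMeasure (ν i)]

lemma lintegral_pi_prod {f : ι → ℝ → ℝ≥0∞} (hf : ∀ i, Measurable (f i)) :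
    ∫⁻ x, ∏ i, f i (x i) ∂(Measure.pi ν) = ∏ i, ∫⁻ y, f i y ∂(ν i) := by
  refine (lintegral_prod_eq_prod_lintegral_of_indepFun Finset.univ (fun i (x : ι → ℝ) => f i (x i))
    (iIndepFun_pi fun i => (hf i).aemeasurable)
    (fun i => (hf i).comp (measurable_pi_apply i))).trans ?_
  refine Finset.prod_congr rfl fun i _ => ?_
  rw [← (measurePreserving_eval ν i).map_eq, lintegral_map (hf i) (measurable_pi_apply i)]

lemma lintegral_pi_exp_sum {g : ι → ℝ → ℝ} (hg : ∀ i, Measurable (g i)) :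
    ∫⁻ x, ENNReal.ofReal (Real.exp (∑ i, g i (x i))) ∂(Measure.pi ν)
      = ∏ i, ∫⁻ y, ENNReal.ofReal (Real.exp (g i y)) ∂(ν i) := by
  rw [← lintegral_pi_prod (fun i => by have := hg i; fun_prop)]
  refine lintegral_congr fun x => ?_
  rw [Real.exp_sum, ENNReal.ofReal_prod_of_nonneg fun i _ => (Real.exp_pos _).le]

lemma ENNReal.prod_ofReal_exp (c : ι → ℝ) :
    ∏ i, ENNReal.ofReal (Real.exp (c i)) = ENNReal.ofReal (Real.exp (∑ i, c i)) := by
  rw [Real.exp_sum, ENNReal.ofReal_prod_of_nonneg fun i _ => (Real.exp_pos _).le]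

lemma lintegral_pi_exp_sum_le {g : ι → ℝ → ℝ} (hg : ∀ i, Measurable (g i)) {c : ι → ℝ}
    (h : ∀ i, ∫⁻ y, ENNReal.ofReal (Real.exp (g i y)) ∂(ν i) ≤ ENNReal.ofReal (Real.exp (c i))) :
    ∫⁻ x, ENNReal.ofReal (Real.exp (∑ i, g i (x i))) ∂(Measure.pi ν)
      ≤ ENNReal.ofReal (Real.exp (∑ i, c i)) := by
  rw [lintegral_pi_exp_sum hg, ← ENNReal.prod_ofReal_exp]
  exact Finset.prod_le_prod' fun i _ => h i

variable [DecidableEq ι] {σ : ℝ}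

/-- Gaussian linearisation: `exp (s|Bx|²)` is the mean of `exp (√(2s) ⟨Bx, z⟩)` over a standard
Gaussian `z`. After exchanging integrals, the linear form in `x` contributes `exp (2σs |Bᵀz|²)`, and
diagonality of `B * Bᵀ` splits this into one-dimensional Gaussian integrals. -/
lemma lintegral_exp_sq_le_of_mul_transpose_eq_diagonal (hσ0 : 0 ≤ σ)
    (hσ : ∀ i s, ∫⁻ y, ENNReal.ofReal (Real.exp (s * y)) ∂(ν i)
      ≤ ENNReal.ofReal (Real.exp (σ * s ^ 2)))
    {B : Matrix ι ι ℝ} {l : ι → ℝ} (hB : B * Bᵀ = Matrix.diagonal l) {s : ℝ} (hs : 0 ≤ s)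
    (hl : ∀ k, 8 * σ * s * l k ≤ 1) :
    ∫⁻ x, ENNReal.ofReal (Real.exp (s * ((B *ᵥ x) ⬝ᵥ (B *ᵥ x)))) ∂(Measure.pi ν)
      ≤ ENNReal.ofReal (Real.exp (4 * σ * s * ∑ k, l k)) := by
  set γ : Measure (ι → ℝ) := Measure.pi fun _ => gaussianReal 0 1 with hγ
  have hl0 : ∀ k, 0 ≤ l k := fun k => by
    have := congrFun (congrFun hB k) k
    rw [Matrix.diagonal_apply_eq, Matrix.mul_apply] at this
    rw [← this]
    exact Finset.sum_nonneg fun i _ => mul_self_nonneg _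
  have hlin : ∀ x : ι → ℝ, ENNReal.ofReal (Real.exp (s * ((B *ᵥ x) ⬝ᵥ (B *ᵥ x))))
      = ∫⁻ z, ENNReal.ofReal (Real.exp (∑ k, √(2 * s) * (B *ᵥ x) k * z k)) ∂γ := by
    intro x
    rw [lintegral_pi_exp_sum (g := fun k y => √(2 * s) * (B *ᵥ x) k * y) (fun k => by fun_prop)]
    simp_rw [lintegral_exp_mul_gaussianReal]
    rw [ENNReal.prod_ofReal_exp, dotProduct, Finset.mul_sum]
    congr 2
    refine Finset.sum_congr rfl fun k _ => ?_
    rw [mul_pow, Real.sq_sqrt (by positivity)]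
    ring
  simp_rw [hlin]
  rw [lintegral_lintegral_swap (by
    simp only [Function.uncurry_def, Matrix.mulVec, dotProduct]
    fun_prop)]
  have hswap : ∀ x z : ι → ℝ, ∑ k, √(2 * s) * (B *ᵥ x) k * z k
      = ∑ i, (√(2 * s) * (z ᵥ* B) i) * x i := by
    intro x z
    have := Matrix.dotProduct_mulVec z B x
    simp only [dotProduct] at this
    calc _ = √(2 * s) * ∑ k, z k * (B *ᵥ x) k := by
          rw [Finset.mul_sum]; exact Finset.sum_congr rfl fun k _ => by ring
      _ = _ := by
          rw [this, Finset.mul_sum]; exact Finset.sum_congr rfl fun k _ => by ring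
  have hinner : ∀ z : ι → ℝ,
      ∫⁻ x, ENNReal.ofReal (Real.exp (∑ k, √(2 * s) * (B *ᵥ x) k * z k)) ∂(Measure.pi ν)
        ≤ ENNReal.ofReal (Real.exp (∑ k, (2 * σ * s * l k) * z k ^ 2)) := by
    intro z
    simp_rw [hswap]
    refine (lintegral_pi_exp_sum_le (g := fun i y => √(2 * s) * (z ᵥ* B) i * y)
      (fun i => by fun_prop) (fun i => hσ i _)).trans (le_of_eq ?_)
    congr 2
    have h1 : (z ᵥ* B) ⬝ᵥ (z ᵥ* B) = ∑ k, l k * z k ^ 2 := by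
      rw [← Matrix.dotProduct_mulVec, ← Matrix.mulVec_transpose, Matrix.mulVec_mulVec, hB,
        dotProduct]
      refine Finset.sum_congr rfl fun k _ => ?_
      rw [Matrix.mulVec_diagonal]
      ring
    calc _ = 2 * σ * s * ((z ᵥ* B) ⬝ᵥ (z ᵥ* B)) := by
          rw [dotProduct, Finset.mul_sum]
          refine Finset.sum_congr rfl fun i _ => ?_
          rw [mul_pow, Real.sq_sqrt (by positivity)]
          ring
      _ = _ := by
          rw [h1, Finset.mul_sum]
          exact Finset.sum_congr rfl fun k _ => by ring
  refine (lintegral_mono hinner).trans ?_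
  refine (lintegral_pi_exp_sum_le (g := fun k y => 2 * σ * s * l k * y ^ 2)
    (fun k => by fun_prop) (fun k => lintegral_exp_mul_sq_gaussianReal_le ?_ ?_)).trans
    (le_of_eq ?_)
  · have := hl0 k
    positivity
  · linarith [hl k]
  · congr 2
    rw [Finset.mul_sum]
    exact Finset.sum_congr rfl fun k _ => by ring

lemma Matrix.exists_orthogonal_diagonalization (A : Matrix ι ι ℝ) :
    ∃ (U : Matrix ι ι ℝ) (l : ι → ℝ), Uᵀ * U = 1 ∧ U * Uᵀ = 1 ∧
      (Uᵀ * A) * (Uᵀ * A)ᵀ = Matrix.diagonal l := by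
  have hA : (A * Aᵀ).IsHermitian := by
    simp [Matrix.IsHermitian]
  refine ⟨hA.eigenvectorUnitary, hA.eigenvalues, ?_, ?_, ?_⟩
  · exact Unitary.coe_star_mul_self hA.eigenvectorUnitary
  · exact Unitary.coe_mul_star_self hA.eigenvectorUnitary
  · have h := hA.conjStarAlgAut_star_eigenvectorUnitary
    rw [Unitary.conjStarAlgAut_star_apply] at h
    rw [Matrix.transpose_mul, Matrix.transpose_transpose]
    simpa only [Matrix.mul_assoc] using! h

/-- Exponential moments of the squared norm of a linear image of a vector with independent
sub-gaussian entries. -/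
lemma lintegral_exp_mulVec_sq_le (hσ0 : 0 ≤ σ)
    (hσ : ∀ i s, ∫⁻ y, ENNReal.ofReal (Real.exp (s * y)) ∂(ν i)
      ≤ ENNReal.ofReal (Real.exp (σ * s ^ 2)))
    {A : Matrix ι ι ℝ} {N : ℝ} (hN : ∀ v, (Aᵀ *ᵥ v) ⬝ᵥ (Aᵀ *ᵥ v) ≤ N * (v ⬝ᵥ v))
    {s : ℝ} (hs : 0 ≤ s) (hsN : 8 * σ * s * N ≤ 1) :
    ∫⁻ x, ENNReal.ofReal (Real.exp (s * ((A *ᵥ x) ⬝ᵥ (A *ᵥ x)))) ∂(Measure.pi ν)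
      ≤ ENNReal.ofReal (Real.exp (4 * σ * s * (A * Aᵀ).trace)) := by
  obtain ⟨U, l, hU1, hU2, hl⟩ := A.exists_orthogonal_diagonalization
  have hsq : ∀ x : ι → ℝ, (A *ᵥ x) ⬝ᵥ (A *ᵥ x) = ((Uᵀ * A) *ᵥ x) ⬝ᵥ ((Uᵀ * A) *ᵥ x) := by
    intro x
    rw [← Matrix.mulVec_mulVec, Matrix.dotProduct_mulVec (Uᵀ *ᵥ (A *ᵥ x)),
      Matrix.vecMul_transpose, Matrix.mulVec_mulVec, hU2, Matrix.one_mulVec]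
  have htr : (A * Aᵀ).trace = ∑ k, l k := by
    rw [← Matrix.trace_diagonal, ← hl, Matrix.transpose_mul, Matrix.transpose_transpose,
      ← Matrix.mul_assoc, Matrix.trace_mul_comm _ U, ← Matrix.mul_assoc, ← Matrix.mul_assoc, hU2,
      Matrix.one_mul]
  -- Each `l k` is the value of the form of `A * Aᵀ` at a unit eigenvector.
  have hlN : ∀ k, l k ≤ N := by
    intro k
    have h := hN (U.col k)
    have h1 : (U.col k) ⬝ᵥ (U.col k) = 1 := by
      have := congrFun (congrFun hU1 k) k
      simpa [Matrix.mul_apply, dotProduct] using this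
    have h2 : (Aᵀ *ᵥ U.col k) ⬝ᵥ (Aᵀ *ᵥ U.col k) = l k := by
      have := congrFun (congrFun hl k) k
      rw [Matrix.diagonal_apply_eq] at this
      rw [← this, Matrix.mul_apply, dotProduct]
      refine Finset.sum_congr rfl fun i _ => ?_
      rw [Matrix.transpose_apply]
      congr 1 <;>
      · rw [Matrix.mul_apply, Matrix.mulVec, dotProduct]
        exact Finset.sum_congr rfl fun j _ => by simp [mul_comm]
    rw [h1, h2, mul_one] at h
    exact h
  simp_rw [hsq]
  rw [htr]
  refine lintegral_exp_sq_le_of_mul_transpose_eq_diagonal hσ0 hσ hl hs fun k => ?_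
  have : 8 * σ * s * l k ≤ 8 * σ * s * N := by
    have := hlN k
    gcongr
  linarith

/-- Independent coordinates allow the blocks inside and outside `I` to be drawn from two independent
copies. -/
lemma measurePreserving_piecewise (I : Finset ι) :
    MeasurePreserving (fun q : (ι → ℝ) × (ι → ℝ) => fun i => if i ∈ I then q.1 i else q.2 i)
      ((Measure.pi ν).prod (Measure.pi ν)) (Measure.pi ν) := by
  have hmeas : Measurable
      (fun q : (ι → ℝ) × (ι → ℝ) => fun i => if i ∈ I then q.1 i else q.2 i) := by
    refine measurable_pi_lambda _ fun i => ?_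
    split_ifs <;> fun_prop
  refine ⟨hmeas, (Measure.pi_eq fun t ht => ?_).symm⟩
  rw [Measure.map_apply hmeas (MeasurableSet.univ_pi ht)]
  have : (fun q : (ι → ℝ) × (ι → ℝ) => fun i => if i ∈ I then q.1 i else q.2 i) ⁻¹'
      (Set.univ.pi t) = (Set.univ.pi fun i => if i ∈ I then t i else Set.univ) ×ˢ
        (Set.univ.pi fun i => if i ∈ I then Set.univ else t i) := by
    ext q
    simp only [Set.mem_preimage, Set.mem_univ_pi, Set.mem_prod]
    rw [← forall_and]
    refine forall_congr' fun i => ?_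
    by_cases hi : i ∈ I <;> simp [hi]
  rw [this, Measure.prod_prod, Measure.pi_pi, Measure.pi_pi, ← Finset.prod_mul_distrib]
  refine Finset.prod_congr rfl fun i _ => ?_
  by_cases hi : i ∈ I <;> simp [hi]

/-- The form couples only coordinates in `I` with coordinates outside. Given the former it is linear
in the latter, and integrating these leaves `exp (σt²|Mx|²)`, covered by
`lintegral_exp_mulVec_sq_le` with `s = σt²`. -/
lemma lintegral_exp_bipartite_le (hσ0 : 0 ≤ σ)
    (hσ : ∀ i s, ∫⁻ y, ENNReal.ofReal (Real.exp (s * y)) ∂(ν i)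
      ≤ ENNReal.ofReal (Real.exp (σ * s ^ 2)))
    {A : Matrix ι ι ℝ} {N : ℝ} (hN0 : 0 ≤ N) (hN : ∀ v, (A *ᵥ v) ⬝ᵥ (A *ᵥ v) ≤ N * (v ⬝ᵥ v))
    {t : ℝ} (htN : 8 * σ ^ 2 * t ^ 2 * N ≤ 1) (I : Finset ι) :
    ∫⁻ x, ENNReal.ofReal (Real.exp
        (t * ∑ i, ∑ j, (if i ∈ I ∧ j ∉ I then A i j else 0) * x i * x j)) ∂(Measure.pi ν)
      ≤ ENNReal.ofReal (Real.exp (4 * σ ^ 2 * t ^ 2 * ∑ i, ∑ j, A i j ^ 2)) := by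
  set M : Matrix ι ι ℝ := Matrix.of fun j i => if i ∈ I ∧ j ∉ I then A i j else 0 with hM
  -- Erasing coordinates before and after applying `A` does not increase norms.
  have hMN : ∀ v, (Mᵀ *ᵥ v) ⬝ᵥ (Mᵀ *ᵥ v) ≤ N * (v ⬝ᵥ v) := by
    intro v
    set w : ι → ℝ := fun j => if j ∈ I then 0 else v j with hw
    have h1 : ∀ i, (Mᵀ *ᵥ v) i = if i ∈ I then (A *ᵥ w) i else 0 := by
      intro i
      simp only [Matrix.mulVec, dotProduct, Matrix.transpose_apply, hM, Matrix.of_apply, hw]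
      by_cases hi : i ∈ I
      · simp only [hi, true_and, if_true]
        refine Finset.sum_congr rfl fun j _ => ?_
        by_cases hj : j ∈ I <;> simp [hj]
      · simp [hi]
    calc (Mᵀ *ᵥ v) ⬝ᵥ (Mᵀ *ᵥ v) ≤ (A *ᵥ w) ⬝ᵥ (A *ᵥ w) := by
          refine Finset.sum_le_sum fun i _ => ?_
          rw [h1]
          split_ifs
          · exact le_rfl
          · simpa using mul_self_nonneg _
      _ ≤ N * (w ⬝ᵥ w) := hN w
      _ ≤ N * (v ⬝ᵥ v) := by
          refine mul_le_mul_of_nonneg_left (Finset.sum_le_sum fun j _ => ?_) hN0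
          simp only [hw]
          split_ifs
          · simpa using mul_self_nonneg _
          · exact le_rfl
  have hexp : Measurable fun x : ι → ℝ => ENNReal.ofReal (Real.exp
        (t * ∑ i, ∑ j, (if i ∈ I ∧ j ∉ I then A i j else 0) * x i * x j)) := by fun_prop
  rw [← (measurePreserving_piecewise (ν := ν) I).lintegral_comp hexp, lintegral_prod]
  swap
  · exact (hexp.comp (measurePreserving_piecewise (ν := ν) I).measurable).aemeasurable
  have hsplit : ∀ x y : ι → ℝ, t * ∑ i, ∑ j, (if i ∈ I ∧ j ∉ I then A i j else 0)
        * (if i ∈ I then x i else y i) * (if j ∈ I then x j else y j)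
      = ∑ j, (t * (M *ᵥ x) j) * y j := by
    intro x y
    rw [Finset.sum_comm, Finset.mul_sum]
    refine Finset.sum_congr rfl fun j _ => ?_
    rw [mul_assoc, Matrix.mulVec, dotProduct, Finset.sum_mul]
    congr 1
    refine Finset.sum_congr rfl fun i _ => ?_
    simp only [hM, Matrix.of_apply]
    by_cases hi : i ∈ I <;> by_cases hj : j ∈ I <;> simp [hi, hj]
  have hinner : ∀ x : ι → ℝ, ∫⁻ y, ENNReal.ofReal (Real.exp
        (t * ∑ i, ∑ j, (if i ∈ I ∧ j ∉ I then A i j else 0)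
        * (if i ∈ I then x i else y i) * (if j ∈ I then x j else y j))) ∂(Measure.pi ν)
      ≤ ENNReal.ofReal (Real.exp (σ * t ^ 2 * ((M *ᵥ x) ⬝ᵥ (M *ᵥ x)))) := by
    intro x
    simp_rw [hsplit]
    refine (lintegral_pi_exp_sum_le (g := fun j y => t * (M *ᵥ x) j * y)
      (fun j => by fun_prop) (fun j => hσ j _)).trans (le_of_eq ?_)
    congr 2
    rw [dotProduct, Finset.mul_sum]
    exact Finset.sum_congr rfl fun j _ => by ring
  refine (lintegral_mono hinner).trans ?_
  refine (lintegral_exp_mulVec_sq_le hσ0 hσ hMN (by positivity) (by linarith)).trans ?_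
  apply ENNReal.ofReal_le_ofReal
  apply Real.exp_le_exp.2
  have htr : (M * Mᵀ).trace ≤ ∑ i, ∑ j, A i j ^ 2 := by
    rw [Finset.sum_comm, Matrix.trace]
    refine Finset.sum_le_sum fun j _ => ?_
    rw [Matrix.diag_apply, Matrix.mul_apply]
    refine Finset.sum_le_sum fun i _ => ?_
    rw [Matrix.transpose_apply, hM, Matrix.of_apply]
    split_ifs
    · rw [sq]
    · simpa using sq_nonneg _
  calc 4 * σ * (σ * t ^ 2) * (M * Mᵀ).trace
      ≤ 4 * σ * (σ * t ^ 2) * ∑ i, ∑ j, A i j ^ 2 := by gcongr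
    _ = _ := by ring

/-- A quarter of all subsets contain `i` and avoid `j`, so weight 4 makes the average over subsets
recover each off-diagonal entry. -/
lemma sum_finset_indicator_mem_not_mem {i j : ι} (hij : i ≠ j) :
    ∑ I : Finset ι, (if i ∈ I ∧ j ∉ I then (4 : ℝ) else 0) = 2 ^ Fintype.card ι := by
  have h1 : (Finset.univ.filter fun I : Finset ι => i ∈ I ∧ j ∉ I)
      = Finset.Icc {i} (Finset.univ.erase j) := by
    ext I
    simp only [Finset.mem_filter, Finset.mem_univ, true_and, Finset.mem_Icc,
      Finset.singleton_subset_iff]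
    refine and_congr_right fun _ => ⟨fun hj x hx => ?_, fun h hj => ?_⟩
    · exact Finset.mem_erase.2 ⟨fun e => hj (e ▸ hx), Finset.mem_univ _⟩
    · exact absurd (h hj) (by simp)
  rw [← Finset.sum_filter, Finset.sum_const, h1,
    Finset.card_Icc_finset (by simpa using hij), Finset.card_erase_of_mem (Finset.mem_univ _),
    Finset.card_univ, Finset.card_singleton]
  have hc : 2 ≤ Fintype.card ι := by
    have := Fintype.one_lt_card_iff.2 ⟨i, j, hij⟩
    omega
  obtain ⟨k, hk⟩ := Nat.exists_eq_add_of_le hc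
  rw [hk, show 2 + k - 1 - 1 = k by omega, pow_add]
  simp
  ring

/-- Exponential moments of the off-diagonal part of a quadratic form, by decoupling. -/
lemma lintegral_exp_offDiag_le (hσ0 : 0 ≤ σ)
    (hσ : ∀ i s, ∫⁻ y, ENNReal.ofReal (Real.exp (s * y)) ∂(ν i)
      ≤ ENNReal.ofReal (Real.exp (σ * s ^ 2)))
    {A : Matrix ι ι ℝ} {N : ℝ} (hN0 : 0 ≤ N) (hN : ∀ v, (A *ᵥ v) ⬝ᵥ (A *ᵥ v) ≤ N * (v ⬝ᵥ v))
    {t : ℝ} (htN : 128 * σ ^ 2 * t ^ 2 * N ≤ 1) :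
    ∫⁻ x, ENNReal.ofReal (Real.exp
        (t * ∑ i, ∑ j, (if i = j then 0 else A i j) * x i * x j)) ∂(Measure.pi ν)
      ≤ ENNReal.ofReal (Real.exp (64 * σ ^ 2 * t ^ 2 * ∑ i, ∑ j, A i j ^ 2)) := by
  set w : ℝ := (2 ^ Fintype.card ι : ℝ)⁻¹ with hw
  have hw0 : 0 < w := by positivity
  have hwsum : ∑ _I : Finset ι, w = 1 := by
    rw [Finset.sum_const, Finset.card_univ, Fintype.card_finset, nsmul_eq_mul, hw]
    push_cast
    exact mul_inv_cancel₀ (by positivity)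
  have havg : ∀ x : ι → ℝ, t * ∑ i, ∑ j, (if i = j then 0 else A i j) * x i * x j
      = ∑ I : Finset ι, w • ((4 * t) *
        ∑ i, ∑ j, (if i ∈ I ∧ j ∉ I then A i j else 0) * x i * x j) := by
    intro x
    simp only [smul_eq_mul, Finset.mul_sum]
    symm
    refine Finset.sum_comm.trans (Finset.sum_congr rfl fun i _ =>
      Finset.sum_comm.trans (Finset.sum_congr rfl fun j _ => ?_))
    symm
    by_cases hij : i = j
    · subst hij
      simp
    · have h := sum_finset_indicator_mem_not_mem hij
      calc t * ((if i = j then 0 else A i j) * x i * x j)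
          = (w * 2 ^ Fintype.card ι) * (t * (A i j * x i * x j)) := by
            rw [if_neg hij, hw, inv_mul_cancel₀ (by positivity), one_mul]
        _ = _ := by
            rw [← h, Finset.mul_sum, Finset.sum_mul]
            refine Finset.sum_congr rfl fun I _ => ?_
            split_ifs <;> ring
  -- Jensen moves the average over subsets outside the exponential. The price is `4t` for `t`, a
  -- factor 16 in the constants.
  have hjensen : ∀ x : ι → ℝ, ENNReal.ofReal (Real.exp
        (t * ∑ i, ∑ j, (if i = j then 0 else A i j) * x i * x j))
      ≤ ∑ I : Finset ι, ENNReal.ofReal w * ENNReal.ofReal (Real.exp ((4 * t) *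
        ∑ i, ∑ j, (if i ∈ I ∧ j ∉ I then A i j else 0) * x i * x j)) := by
    intro x
    rw [havg]
    simp_rw [← ENNReal.ofReal_mul hw0.le]
    rw [← ENNReal.ofReal_sum_of_nonneg (fun I _ => mul_nonneg hw0.le (Real.exp_pos _).le)]
    apply ENNReal.ofReal_le_ofReal
    exact convexOn_exp.map_sum_le (fun _ _ => hw0.le) hwsum (fun _ _ => Set.mem_univ _)
  refine (lintegral_mono hjensen).trans ?_
  rw [lintegral_finsetSum _ (fun I _ => by fun_prop)]
  calc _ ≤ ∑ I : Finset ι, ENNReal.ofReal w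
        * ENNReal.ofReal (Real.exp (64 * σ ^ 2 * t ^ 2 * ∑ i, ∑ j, A i j ^ 2)) := by
        refine Finset.sum_le_sum fun I _ => ?_
        rw [lintegral_const_mul _ (by fun_prop)]
        refine mul_le_mul_right ((lintegral_exp_bipartite_le hσ0 hσ hN0 hN
          (by linarith) I).trans (le_of_eq ?_)) _
        congr 2
        ring
    _ = _ := by
        rw [← Finset.sum_mul, ← ENNReal.ofReal_sum_of_nonneg (fun _ _ => hw0.le), hwsum]
        simp

end ProductMeasure

/-! ### Hanson-Wright bound, combining diagonal and off-diagonal parts. -/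

section HansonWright

variable {ι : Type*} [Fintype ι] [DecidableEq ι]

lemma Matrix.sum_col_sq_le {A : Matrix ι ι ℝ} {N : ℝ}
    (hN : ∀ v, (A *ᵥ v) ⬝ᵥ (A *ᵥ v) ≤ N * (v ⬝ᵥ v)) (j : ι) : ∑ i, A i j ^ 2 ≤ N := by
  have h := hN (Pi.single j 1)
  rw [Matrix.mulVec_single_one, dotProduct_single, Pi.single_eq_same, mul_one, mul_one] at h
  simpa [dotProduct, sq] using h

/-- A Hanson-Wright type bound for quadratic forms with nonnegative diagonal. -/
lemma lintegral_exp_quadForm_le {ν : ι → Measure ℝ} [∀ i, IsProbabilityMeasure (ν i)] {K : ℝ}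
    (hmgf : ∀ i s, ∫⁻ y, ENNReal.ofReal (Real.exp (s * y)) ∂(ν i)
      ≤ ENNReal.ofReal (Real.exp (11 * K ^ 2 * s ^ 2)))
    (hsq : ∀ i a, 0 ≤ a → 12 * a * K ^ 2 ≤ 1 →
      ∫⁻ y, ENNReal.ofReal (Real.exp (a * y ^ 2)) ∂(ν i)
        ≤ ENNReal.ofReal (Real.exp (a + 72 * K ^ 4 * a ^ 2)))
    {A : Matrix ι ι ℝ} (hA : ∀ i, 0 ≤ A i i) {N : ℝ} (hN0 : 0 ≤ N)
    (hN : ∀ v, (A *ᵥ v) ⬝ᵥ (A *ᵥ v) ≤ N * (v ⬝ᵥ v))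
    {t : ℝ} (ht : 0 ≤ t) (htN : 65536 * K ^ 4 * t ^ 2 * N ≤ 1) :
    ∫⁻ x, ENNReal.ofReal (Real.exp (t * (x ⬝ᵥ (A *ᵥ x)))) ∂(Measure.pi ν)
      ≤ ENNReal.ofReal (Real.exp
          (t * A.trace + 32768 * K ^ 4 * t ^ 2 * ∑ i, ∑ j, A i j ^ 2)) := by
  set F : ℝ := ∑ i, ∑ j, A i j ^ 2 with hF
  set O : (ι → ℝ) → ℝ := fun x => ∑ i, ∑ j, (if i = j then 0 else A i j) * x i * x j with hO
  have hF0 : 0 ≤ F := Finset.sum_nonneg fun i _ => Finset.sum_nonneg fun j _ => sq_nonneg _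
  have hdiagF : ∑ i, A i i ^ 2 ≤ F := Finset.sum_le_sum fun i _ =>
    Finset.single_le_sum (f := fun j => A i j ^ 2) (fun j _ => sq_nonneg _) (Finset.mem_univ i)
  have hquad : ∀ x : ι → ℝ, x ⬝ᵥ (A *ᵥ x) = ∑ i, A i i * x i ^ 2 + O x := by
    intro x
    simp only [hO, dotProduct, Matrix.mulVec, Finset.mul_sum]
    rw [← Finset.sum_add_distrib]
    refine Finset.sum_congr rfl fun i _ => ?_
    rw [← Finset.add_sum_erase _ _ (Finset.mem_univ i),
      ← Finset.add_sum_erase _ (fun j => (if i = j then 0 else A i j) * x i * x j)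
        (Finset.mem_univ i)]
    simp only [if_true, zero_mul, zero_add]
    congr 1
    · ring
    · refine Finset.sum_congr rfl fun j hj => ?_
      rw [if_neg (Finset.ne_of_mem_erase hj).symm]
      ring
  have hsmall : ∀ i, 12 * (2 * t * A i i) * K ^ 2 ≤ 1 := by
    intro i
    have h1 : A i i ^ 2 ≤ N := (Finset.single_le_sum (f := fun k => A k i ^ 2)
      (fun k _ => sq_nonneg _) (Finset.mem_univ i)).trans (Matrix.sum_col_sq_le hN i)
    have h2 : (256 * K ^ 2 * t * A i i) ^ 2 ≤ 1 ^ 2 := by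
      calc _ = 65536 * K ^ 4 * t ^ 2 * A i i ^ 2 := by ring
        _ ≤ 65536 * K ^ 4 * t ^ 2 * N := by gcongr
        _ ≤ 1 ^ 2 := by simpa using htN
    have h3 := le_of_sq_le_sq h2 zero_le_one
    have h4 : 0 ≤ K ^ 2 * t * A i i := by
      have := hA i
      positivity
    linarith
  have hD : ∫⁻ x, ENNReal.ofReal (Real.exp (∑ i, 2 * t * A i i * x i ^ 2)) ∂(Measure.pi ν)
      ≤ ENNReal.ofReal (Real.exp (2 * t * A.trace + 288 * K ^ 4 * t ^ 2 * F)) := by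
    refine (lintegral_pi_exp_sum_le (g := fun i y => 2 * t * A i i * y ^ 2) (fun i => by fun_prop)
      (fun i => hsq i _ (by have := hA i; positivity) (hsmall i))).trans ?_
    apply ENNReal.ofReal_le_ofReal
    apply Real.exp_le_exp.2
    calc _ = 2 * t * A.trace + 288 * K ^ 4 * t ^ 2 * ∑ i, A i i ^ 2 := by
          rw [Finset.sum_add_distrib, Matrix.trace, Finset.mul_sum, Finset.mul_sum]
          congr 1
          refine Finset.sum_congr rfl fun i _ => by ring
      _ ≤ _ := by gcongr
  have hOff : ∫⁻ x, ENNReal.ofReal (Real.exp (2 * t * O x)) ∂(Measure.pi ν)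
      ≤ ENNReal.ofReal (Real.exp (30976 * K ^ 4 * t ^ 2 * F)) := by
    have h5 : 0 ≤ K ^ 4 * t ^ 2 * N := by positivity
    refine (lintegral_exp_offDiag_le (by positivity) hmgf hN0 hN (by nlinarith)).trans
      (le_of_eq ?_)
    congr 2
    ring
  -- Midpoint convexity separates the two parts at the cost of doubling `t`. The shifts by `∓t tr A`
  -- balance them: the diagonal part has first-order term `2t tr A` and the off-diagonal part none,
  -- so both end at `t tr A`.
  have hconv : ∀ x : ι → ℝ, ENNReal.ofReal (Real.exp (t * (x ⬝ᵥ (A *ᵥ x))))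
      ≤ ENNReal.ofReal (1 / 2 * Real.exp (-(t * A.trace)))
          * ENNReal.ofReal (Real.exp (∑ i, 2 * t * A i i * x i ^ 2))
        + ENNReal.ofReal (1 / 2 * Real.exp (t * A.trace))
          * ENNReal.ofReal (Real.exp (2 * t * O x)) := by
    intro x
    rw [← ENNReal.ofReal_mul (by positivity), ← ENNReal.ofReal_mul (by positivity),
      ← ENNReal.ofReal_add (by positivity) (by positivity)]
    apply ENNReal.ofReal_le_ofReal
    rw [mul_assoc, mul_assoc, ← Real.exp_add, ← Real.exp_add]
    have h := convexOn_exp.2 (Set.mem_univ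
      (-(t * A.trace) + ∑ i, 2 * t * A i i * x i ^ 2)) (Set.mem_univ (t * A.trace + 2 * t * O x))
      (by norm_num : (0 : ℝ) ≤ 1 / 2) (by norm_num : (0 : ℝ) ≤ 1 / 2) (by norm_num)
    simp only [smul_eq_mul] at h
    refine le_of_eq_of_le ?_ h
    congr 1
    rw [hquad]
    have : ∑ i, 2 * t * A i i * x i ^ 2 = 2 * t * ∑ i, A i i * x i ^ 2 := by
      rw [Finset.mul_sum]
      exact Finset.sum_congr rfl fun i _ => by ring
    rw [this]
    ring
  refine (lintegral_mono hconv).trans ?_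
  rw [lintegral_add_left (by fun_prop), lintegral_const_mul _ (by fun_prop),
    lintegral_const_mul _ (by fun_prop)]
  refine (add_le_add (mul_le_mul_right hD _) (mul_le_mul_right hOff _)).trans ?_
  rw [← ENNReal.ofReal_mul (by positivity), ← ENNReal.ofReal_mul (by positivity),
    ← ENNReal.ofReal_add (by positivity) (by positivity)]
  apply ENNReal.ofReal_le_ofReal
  rw [mul_assoc (1 / 2 : ℝ), mul_assoc (1 / 2 : ℝ), ← Real.exp_add, ← Real.exp_add]
  have hKF : 0 ≤ K ^ 4 * t ^ 2 * F := by positivity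
  have e1 : Real.exp (-(t * A.trace) + (2 * t * A.trace + 288 * K ^ 4 * t ^ 2 * F))
      ≤ Real.exp (t * A.trace + 32768 * K ^ 4 * t ^ 2 * F) := Real.exp_le_exp.2 (by linarith)
  have e2 : Real.exp (t * A.trace + 30976 * K ^ 4 * t ^ 2 * F)
      ≤ Real.exp (t * A.trace + 32768 * K ^ 4 * t ^ 2 * F) := Real.exp_le_exp.2 (by linarith)
  linarith

end HansonWright

/-! ### Bernoulli exponential moments. -/

section Bernoulli

variable {Ω : Type*} [MeasurableSpace Ω] {μ : Measure Ω} {ξ : Ω → ℝ}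
  {p : ℝ}

lemma integrable_of_ae_zero_or_one [IsFiniteMeasure μ] (hξ : Measurable ξ) (h01 : ∀ᵐ ω ∂μ, ξ ω = 0 ∨ ξ ω = 1) :
    Integrable ξ μ := by
  refine (integrable_const (1 : ℝ)).mono' hξ.aestronglyMeasurable ?_
  filter_upwards [h01] with ω h
  rcases h with h | h <;> simp [h]

lemma mean_nonneg_of_ae_zero_or_one (h01 : ∀ᵐ ω ∂μ, ξ ω = 0 ∨ ξ ω = 1)
    (hp : ∫ ω, ξ ω ∂μ = p) : 0 ≤ p := by
  rw [← hp]
  refine integral_nonneg_of_ae ?_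
  filter_upwards [h01] with ω h
  rcases h with h | h <;> simp [h]

/-- On `{0, 1}` the exponential is affine in `ξ`, so its mean is `1 + p(e^y - 1) ≤ exp (p(e^y -
1))`, and `e^y - 1 ≤ y + y²` for `0 ≤ y ≤ 1`. -/
lemma lintegral_exp_mul_bernoulli_le [IsProbabilityMeasure μ]
    (hξ : Measurable ξ) (h01 : ∀ᵐ ω ∂μ, ξ ω = 0 ∨ ξ ω = 1)
    (hp : ∫ ω, ξ ω ∂μ = p) {y : ℝ} (hy0 : 0 ≤ y) (hy1 : y ≤ 1) :
    ∫⁻ ω, ENNReal.ofReal (Real.exp (y * ξ ω)) ∂μ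
      ≤ ENNReal.ofReal (Real.exp (p * (y + y ^ 2))) := by
  have hp0 := mean_nonneg_of_ae_zero_or_one h01 hp
  have hint := integrable_of_ae_zero_or_one hξ h01
  have heq : ∀ᵐ ω ∂μ, Real.exp (y * ξ ω) = 1 + ξ ω * (Real.exp y - 1) := by
    filter_upwards [h01] with ω h
    rcases h with h | h <;> simp [h]
  have hint2 : Integrable (fun ω => 1 + ξ ω * (Real.exp y - 1)) μ :=
    (integrable_const _).add (hint.mul_const _)
  have hnn : ∀ᵐ ω ∂μ, 0 ≤ 1 + ξ ω * (Real.exp y - 1) := by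
    filter_upwards [heq] with ω h
    rw [← h]
    positivity
  rw [lintegral_congr_ae (heq.mono fun ω h => congrArg ENNReal.ofReal h),
    ← ofReal_integral_eq_lintegral_ofReal hint2 hnn,
    integral_add (integrable_const _) (hint.mul_const _), integral_mul_const, hp]
  apply ENNReal.ofReal_le_ofReal
  have h1 := (abs_le.1 (Real.abs_exp_sub_one_sub_id_le (by rwa [abs_of_nonneg hy0]))).2
  have h2 := Real.add_one_le_exp (p * (Real.exp y - 1))
  have h3 : Real.exp (p * (Real.exp y - 1)) ≤ Real.exp (p * (y + y ^ 2)) := by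
    apply Real.exp_le_exp.2
    gcongr
    linarith
  simp only [integral_const, probReal_univ, smul_eq_mul]
  linarith

end Bernoulli

/-! ### The matrix `D * diagonal e * D` for a 0-1 vector `e`. -/

section Compression

variable {ι : Type*} [Fintype ι] [DecidableEq ι] {D : Matrix ι ι ℝ} {e : ι → ℝ} {T : ℝ}

lemma Matrix.IsSymm.compression_apply_self (hD : D.IsSymm) (i : ι) :
    (D * Matrix.diagonal e * D) i i = ∑ k, e k * D k i ^ 2 := by
  rw [Matrix.mul_apply]
  refine Finset.sum_congr rfl fun k _ => ?_
  rw [Matrix.mul_diagonal, hD.apply]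
  ring

lemma Matrix.IsSymm.trace_compression (hD : D.IsSymm) :
    (D * Matrix.diagonal e * D).trace = ∑ k, e k * ∑ j, D j k ^ 2 := by
  simp only [Matrix.trace, Matrix.diag_apply, hD.compression_apply_self, Finset.mul_sum]
  rw [Finset.sum_comm]
  exact Finset.sum_congr rfl fun k _ => Finset.sum_congr rfl fun j _ => by rw [hD.apply]

lemma Matrix.compression_mulVec (v : ι → ℝ) :
    (D * Matrix.diagonal e * D) *ᵥ v = D *ᵥ fun k => e k * (D *ᵥ v) k := by
  rw [← Matrix.mulVec_mulVec, ← Matrix.mulVec_mulVec]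
  congr 1
  ext k
  rw [Matrix.mulVec_diagonal]

lemma Matrix.compression_mulVec_sq_le (hT : ∀ v, (D *ᵥ v) ⬝ᵥ (D *ᵥ v) ≤ T * (v ⬝ᵥ v))
    (hT0 : 0 ≤ T) (he : ∀ k, e k = 0 ∨ e k = 1) (v : ι → ℝ) :
    ((D * Matrix.diagonal e * D) *ᵥ v) ⬝ᵥ ((D * Matrix.diagonal e * D) *ᵥ v)
      ≤ T ^ 2 * (v ⬝ᵥ v) := by
  rw [Matrix.compression_mulVec]
  refine (hT _).trans ?_
  rw [sq, mul_assoc]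
  refine mul_le_mul_of_nonneg_left (le_trans ?_ (hT v)) hT0
  refine Finset.sum_le_sum fun k _ => ?_
  rcases he k with h | h
  · simpa [h] using mul_self_nonneg _
  · simp [h]

/-- Column `j` is `D` applied to the masked `j`-th column of `D`, whose squared norm is the `j`-th
diagonal entry. The quadratic Frobenius term thus becomes linear in `e`. -/
lemma Matrix.IsSymm.sum_compression_sq_le (hD : D.IsSymm)
    (hT : ∀ v, (D *ᵥ v) ⬝ᵥ (D *ᵥ v) ≤ T * (v ⬝ᵥ v)) (he : ∀ k, e k = 0 ∨ e k = 1) :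
    ∑ i, ∑ j, (D * Matrix.diagonal e * D) i j ^ 2 ≤ T * ∑ k, e k * ∑ j, D j k ^ 2 := by
  rw [Finset.sum_comm, ← hD.trace_compression, Matrix.trace, Finset.mul_sum]
  refine Finset.sum_le_sum fun j _ => ?_
  have h1 : ∑ i, (D * Matrix.diagonal e * D) i j ^ 2
      = ((D * Matrix.diagonal e * D) *ᵥ Pi.single j 1) ⬝ᵥ
          ((D * Matrix.diagonal e * D) *ᵥ Pi.single j 1) := by
    rw [Matrix.mulVec_single_one]
    simp only [dotProduct, Matrix.col_apply, sq]
  rw [h1, Matrix.compression_mulVec, Matrix.diag_apply, hD.compression_apply_self]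
  refine (hT _).trans (le_of_eq ?_)
  congr 1
  rw [dotProduct]
  refine Finset.sum_congr rfl fun k _ => ?_
  rw [Matrix.mulVec_single_one, Matrix.col_apply]
  rcases he k with h | h <;> simp [h, sq]

lemma Matrix.IsSymm.compression_quadForm_nonneg (hD : D.IsSymm) (he : ∀ k, e k = 0 ∨ e k = 1)
    (x : ι → ℝ) : 0 ≤ x ⬝ᵥ ((D * Matrix.diagonal e * D) *ᵥ x) := by
  rw [Matrix.compression_mulVec, Matrix.dotProduct_mulVec, ← Matrix.mulVec_transpose, hD.eq]
  refine Finset.sum_nonneg fun k _ => ?_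
  rcases he k with h | h
  · simp [h]
  · simpa [h] using mul_self_nonneg _

lemma Matrix.measurable_compression_quadForm (D : Matrix ι ι ℝ) :
    Measurable fun q : (ι → ℝ) × (ι → ℝ) =>
      q.2 ⬝ᵥ ((D * Matrix.diagonal q.1 * D) *ᵥ q.2) := by
  have h : ∀ q : (ι → ℝ) × (ι → ℝ), q.2 ⬝ᵥ ((D * Matrix.diagonal q.1 * D) *ᵥ q.2)
      = ∑ i, q.2 i * ∑ k, D i k * (q.1 k * ∑ j, D k j * q.2 j) := fun q => by
    rw [Matrix.compression_mulVec]
    rfl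
  simp_rw [h]
  fun_prop

end Compression

/-! ### Euclidean and operator norms in coordinates. -/

section Norms

variable {m : ℕ}

lemma vecNormTwo_sq (v : Fin m → ℝ) : vecNormTwo v ^ 2 = ∑ i, v i ^ 2 := by
  rw [vecNormTwo, EuclideanSpace.real_norm_sq_eq]

lemma mulVec_sq_le_matOpNorm (A : Matrix (Fin m) (Fin m) ℝ) (v : Fin m → ℝ) :
    (A *ᵥ v) ⬝ᵥ (A *ᵥ v) ≤ matOpNorm A ^ 2 * (v ⬝ᵥ v) := by
  have h := (Matrix.toEuclideanCLM (n := Fin m) (𝕜 := ℝ) A).le_opNorm (WithLp.toLp 2 v)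
  rw [Matrix.toEuclideanCLM_toLp] at h
  have h2 := pow_le_pow_left₀ (norm_nonneg _) h 2
  rw [mul_pow, EuclideanSpace.real_norm_sq_eq, EuclideanSpace.real_norm_sq_eq] at h2
  simpa only [dotProduct, ← sq, matOpNorm] using h2

end Norms

/-! ### Averaging over `X`, then over `ξ`, and the tail bound. -/

section Main

variable {m : ℕ} {Ω : Type*} [MeasurableSpace Ω] {μ : Measure Ω} [IsProbabilityMeasure μ]
  {X ξ : Fin m → Ω → ℝ} {p : Fin m → ℝ} {K : ℝ} {D : Matrix (Fin m) (Fin m) ℝ}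

/-- The moment generating function of a randomly sparsified quadratic form. -/
lemma lintegral_exp_sparse_quadForm_le (hX : ∀ i, Measurable (X i)) (hXi : iIndepFun X μ)
    (hX1 : ∀ i, ∫ ω, X i ω ∂μ = 0) (hK : ∀ i, psiTwoNorm (X i) μ ≤ ENNReal.ofReal K)
    (hX2 : ∀ i, ∫ ω, (X i ω) ^ 2 ∂μ = 1) (hξ : ∀ i, Measurable (ξ i))
    (h01 : ∀ i, ∀ᵐ ω ∂μ, ξ i ω = 0 ∨ ξ i ω = 1) (hξi : iIndepFun ξ μ)
    (hp : ∀ i, ∫ ω, ξ i ω ∂μ = p i)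
    (hXξ : IndepFun (fun ω i => X i ω) (fun ω i => ξ i ω) μ) (hD : D.IsSymm)
    {M T t : ℝ} (hK2 : 1 ≤ 2 * K ^ 2) (ht : 0 ≤ t) (hT0 : 0 ≤ T)
    (hT : ∀ v, (D *ᵥ v) ⬝ᵥ (D *ᵥ v) ≤ T * (v ⬝ᵥ v)) (hM : ∀ k, ∑ j, D j k ^ 2 ≤ M)
    (htT : 256 * K ^ 2 * t * T ≤ 1) :
    ∫⁻ ω, ENNReal.ofReal (Real.exp (t * ((fun i => X i ω) ⬝ᵥ
        ((D * Matrix.diagonal (fun i => ξ i ω) * D) *ᵥ (fun i => X i ω))))) ∂μ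
      ≤ ENNReal.ofReal (Real.exp (t * ∑ i, p i * ∑ j, D j i ^ 2
          + 50000 * K ^ 4 * t ^ 2 * T * M * ∑ i, p i)) := by
  set d : Fin m → ℝ := fun k => ∑ j, D j k ^ 2 with hd
  have hd0 : ∀ k, 0 ≤ d k := fun k => Finset.sum_nonneg fun j _ => sq_nonneg _
  have hdT : ∀ k, d k ≤ T := fun k => Matrix.sum_col_sq_le hT k
  have hp0 : ∀ k, 0 ≤ p k := fun k => mean_nonneg_of_ae_zero_or_one (h01 k) (hp k)
  -- Coefficient of the linear form in `e` left after integrating out `X`.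
  set β : ℝ := t + 32768 * K ^ 4 * t ^ 2 * T with hβ
  have hβ0 : 0 ≤ β := by positivity
  have hβK : β ≤ 130 * (K ^ 2 * t) := by
    have h1 : t * 1 ≤ t * (2 * K ^ 2) := by gcongr
    have h2 : 128 * (K ^ 2 * t) * (256 * K ^ 2 * t * T) ≤ 128 * (K ^ 2 * t) * 1 := by gcongr
    calc β = t + 128 * (K ^ 2 * t) * (256 * K ^ 2 * t * T) := by rw [hβ]; ring
      _ ≤ _ := by linarith
  have hβd : ∀ k, β * d k ≤ 1 := by
    intro k
    have h1 : β * d k ≤ 130 * (K ^ 2 * t) * T := by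
      have := hdT k
      have := hd0 k
      gcongr
    have h2 : 0 ≤ K ^ 2 * t * T := by positivity
    linarith
  have hXm : Measurable fun ω i => X i ω := measurable_pi_lambda _ hX
  have hξm : Measurable fun ω i => ξ i ω := measurable_pi_lambda _ hξ
  have hνp : ∀ i, IsProbabilityMeasure (μ.map (X i)) := fun i =>
    Measure.isProbabilityMeasure_map (hX i).aemeasurable
  have hρp : ∀ i, IsProbabilityMeasure (μ.map (ξ i)) := fun i =>
    Measure.isProbabilityMeasure_map (hξ i).aemeasurable
  have hlaw : μ.map (fun ω => ((fun i => ξ i ω), (fun i => X i ω)))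
      = (Measure.pi fun i => μ.map (ξ i)).prod (Measure.pi fun i => μ.map (X i)) := by
    rw [(indepFun_iff_map_prod_eq_prod_map_map hξm.aemeasurable hXm.aemeasurable).1 hXξ.symm,
      (iIndepFun_iff_map_fun_eq_pi_map fun i => (hξ i).aemeasurable).1 hξi,
      (iIndepFun_iff_map_fun_eq_pi_map fun i => (hX i).aemeasurable).1 hXi]
  have hG : Measurable fun q : (Fin m → ℝ) × (Fin m → ℝ) => ENNReal.ofReal (Real.exp (t *
      (q.2 ⬝ᵥ ((D * Matrix.diagonal q.1 * D) *ᵥ q.2)))) := by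
    have := Matrix.measurable_compression_quadForm D
    fun_prop
  have hae : ∀ᵐ e ∂(Measure.pi fun i => μ.map (ξ i)), ∀ k, e k = 0 ∨ e k = 1 := by
    rw [← (iIndepFun_iff_map_fun_eq_pi_map fun i => (hξ i).aemeasurable).1 hξi]
    refine (ae_map_iff hξm.aemeasurable ?_).2 (ae_all_iff.2 h01)
    simp only [Set.ofPred_forall, Set.ofPred_or]
    exact MeasurableSet.iInter fun k =>
      ((measurableSet_singleton (0 : ℝ)).preimage (measurable_pi_apply k)).union
        ((measurableSet_singleton (1 : ℝ)).preimage (measurable_pi_apply k))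
  calc _ = ∫⁻ q, ENNReal.ofReal (Real.exp (t *
          (q.2 ⬝ᵥ ((D * Matrix.diagonal q.1 * D) *ᵥ q.2))))
          ∂(μ.map (fun ω => ((fun i => ξ i ω), (fun i => X i ω)))) :=
        (lintegral_map hG (hξm.prodMk hXm)).symm
    _ = ∫⁻ e, ∫⁻ x, ENNReal.ofReal (Real.exp (t *
          (x ⬝ᵥ ((D * Matrix.diagonal e * D) *ᵥ x)))) ∂(Measure.pi fun i => μ.map (X i))
          ∂(Measure.pi fun i => μ.map (ξ i)) := by
        rw [hlaw, lintegral_prod _ hG.aemeasurable]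
    _ ≤ ∫⁻ e, ENNReal.ofReal (Real.exp (∑ k, β * d k * e k))
          ∂(Measure.pi fun i => μ.map (ξ i)) := by
        refine lintegral_mono_ae (hae.mono fun e he => ?_)
        have he0 : ∀ k, 0 ≤ e k := fun k => by rcases he k with h | h <;> simp [h]
        refine (lintegral_exp_quadForm_le (K := K) (N := T ^ 2) ?_ ?_ ?_ (by positivity)
          (Matrix.compression_mulVec_sq_le hT hT0 he) ht ?_).trans ?_
        · intro i s
          rw [lintegral_map (by fun_prop) (hX i)]
          exact lintegral_exp_mul_le (hX i) (hX1 i) (hX2 i) (hK i) s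
        · intro i a ha haK
          rw [lintegral_map (by fun_prop) (hX i)]
          exact lintegral_exp_mul_sq_le (hX i) (hX2 i) (hK i) ha haK
        · intro i
          rw [hD.compression_apply_self]
          exact Finset.sum_nonneg fun k _ => mul_nonneg (he0 k) (sq_nonneg _)
        · calc 65536 * K ^ 4 * t ^ 2 * T ^ 2 = (256 * K ^ 2 * t * T) ^ 2 := by ring
            _ ≤ 1 := pow_le_one₀ (by positivity) htT
        · apply ENNReal.ofReal_le_ofReal
          apply Real.exp_le_exp.2
          have hF := hD.sum_compression_sq_le hT he
          rw [hD.trace_compression]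
          calc _ ≤ t * ∑ k, e k * d k + 32768 * K ^ 4 * t ^ 2 * (T * ∑ k, e k * d k) := by
                gcongr
            _ = β * ∑ k, e k * d k := by rw [hβ]; ring
            _ = _ := by
                rw [Finset.mul_sum]
                exact Finset.sum_congr rfl fun k _ => by ring
    _ ≤ ENNReal.ofReal (Real.exp (∑ k, p k * (β * d k + (β * d k) ^ 2))) := by
        refine lintegral_pi_exp_sum_le (g := fun k y => β * d k * y) (fun k => by fun_prop)
          fun k => ?_
        rw [lintegral_map (by fun_prop) (hξ k)]
        exact lintegral_exp_mul_bernoulli_le (hξ k) (h01 k) (hp k)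
          (mul_nonneg hβ0 (hd0 k)) (hβd k)
    _ ≤ _ := by
        apply ENNReal.ofReal_le_ofReal
        apply Real.exp_le_exp.2
        rw [Finset.mul_sum, Finset.mul_sum, ← Finset.sum_add_distrib]
        refine Finset.sum_le_sum fun k _ => ?_
        have h1 : d k ^ 2 ≤ T * M := by
          rw [sq]
          exact mul_le_mul (hdT k) (hM k) (hd0 k) hT0
        have h2 : β ^ 2 ≤ (130 * (K ^ 2 * t)) ^ 2 := by gcongr
        -- The constant covers `32768 + 130² = 49668`.
        have h3 : β * d k + (β * d k) ^ 2 ≤ t * d k + 50000 * K ^ 4 * t ^ 2 * T * M := by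
          have h4 : (β * d k) ^ 2 ≤ (130 * (K ^ 2 * t)) ^ 2 * (T * M) := by
            rw [mul_pow]
            gcongr
          have h5 : 32768 * K ^ 4 * t ^ 2 * T * d k ≤ 32768 * K ^ 4 * t ^ 2 * T * M := by
            have := hM k
            gcongr
          have h6 : 0 ≤ K ^ 4 * t ^ 2 * (T * M) := by
            have := (sq_nonneg (d k)).trans h1
            positivity
          calc β * d k + (β * d k) ^ 2
              ≤ (t * d k + 32768 * K ^ 4 * t ^ 2 * T * d k)
                + (130 * (K ^ 2 * t)) ^ 2 * (T * M) := by
                refine add_le_add (le_of_eq ?_) h4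
                rw [hβ]; ring
            _ ≤ _ := by nlinarith
        calc p k * (β * d k + (β * d k) ^ 2)
            ≤ p k * (t * d k + 50000 * K ^ 4 * t ^ 2 * T * M) :=
              mul_le_mul_of_nonneg_left h3 (hp0 k)
          _ = _ := by ring

end Main

/-- The exponential Markov inequality, in terms of the complementary event. -/
lemma one_sub_exp_le_measureReal_of_lintegral_exp_le {Ω : Type*} [MeasurableSpace Ω]
    {μ : Measure Ω} [IsProbabilityMeasure μ] {Q : Ω → ℝ} (hQ : Measurable Q) {t a R : ℝ}
    (ht : 0 ≤ t) (h : ∫⁻ ω, ENNReal.ofReal (Real.exp (t * Q ω)) ∂μ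
      ≤ ENNReal.ofReal (Real.exp a)) :
    1 - Real.exp (a - t * R) ≤ μ.real {ω | Q ω ≤ R} := by
  have hset : MeasurableSet {ω | Q ω ≤ R} := measurableSet_le hQ measurable_const
  have hbad : μ {ω | Q ω ≤ R}ᶜ ≤ ENNReal.ofReal (Real.exp (a - t * R)) := by
    have h1 := mul_meas_ge_le_lintegral (μ := μ)
      (f := fun ω => ENNReal.ofReal (Real.exp (t * Q ω))) (by fun_prop)
      (ENNReal.ofReal (Real.exp (t * R)))
    have h2 : μ {ω | Q ω ≤ R}ᶜ ≤ μ {ω | ENNReal.ofReal (Real.exp (t * R))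
        ≤ ENNReal.ofReal (Real.exp (t * Q ω))} := by
      refine measure_mono fun ω hω => ?_
      apply ENNReal.ofReal_le_ofReal
      apply Real.exp_le_exp.2
      have : R < Q ω := by simpa using hω
      gcongr
    rw [Real.exp_sub, ENNReal.ofReal_div_of_pos (Real.exp_pos _),
      ENNReal.le_div_iff_mul_le (by simp [Real.exp_pos]) (by simp), mul_comm]
    exact (mul_le_mul_right h2 _).trans (h1.trans h)
  have h3 : μ.real {ω | Q ω ≤ R}ᶜ ≤ Real.exp (a - t * R) :=
    ENNReal.toReal_le_of_le_ofReal (Real.exp_pos _).le hbad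
  rw [probReal_compl_eq_one_sub hset] at h3
  linarith

theorem mainTheorem4 :
    ∃ C : ℝ, 0 < C ∧
      ∀ (m : ℕ), 1 ≤ m →
      ∀ {Ω : Type*} [MeasurableSpace Ω] (μ : Measure Ω) [IsProbabilityMeasure μ]
        (X ξ : Fin m → Ω → ℝ) (p : Fin m → ℝ) (K : ℝ) (D₀ : Matrix (Fin m) (Fin m) ℝ),
        (∀ i, Measurable (X i)) →
        iIndepFun X μ →
        (∀ i, ∫ ω, X i ω ∂μ = 0) →
        (∀ i, psiTwoNorm (X i) μ ≤ ENNReal.ofReal K) →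
        (∀ i, ∫ ω, (X i ω) ^ 2 ∂μ = 1) →
        (∀ i, Measurable (ξ i)) →
        (∀ i, ∀ᵐ ω ∂μ, ξ i ω = 0 ∨ ξ i ω = 1) →
        iIndepFun ξ μ →
        (∀ i, ∫ ω, ξ i ω ∂μ = p i) →
        IndepFun (fun ω i => X i ω) (fun ω i => ξ i ω) μ →
        D₀.IsSymm →
        1 - 4 / (m : ℝ) ^ 4 ≤
          μ.real {ω |
            |(fun i => X i ω) ⬝ᵥ
                ((D₀ * Matrix.diagonal (fun i => ξ i ω) * D₀) *ᵥ (fun i => X i ω))| ≤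
              ∑ i, p i * vecNormTwo (D₀.col i) ^ 2 +
                C * K ^ 2 * √(Real.log m) * matOpNorm D₀ *
                  (√(Real.log m) * matOpNorm D₀ +
                    2 * (⨆ i, vecNormTwo (D₀.col i)) * √(∑ i, p i))} := by
  -- `1280 = 5 * 256`: the 256 cancels the one in `t`, leaving a gain of at least `5 log m`.
  refine ⟨1280, by norm_num, ?_⟩
  intro m hm Ω _ μ _ X ξ p K D hX hXi hX1 hK hX2 hξ h01 hξi hp hXξ hD
  -- For `m = 1` the claimed probability is negative; otherwise `log m > 0`.
  rcases hm.eq_or_lt with rfl | hm2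
  · refine le_trans ?_ measureReal_nonneg
    norm_num
  set T : ℝ := matOpNorm D with hT
  set M : ℝ := ⨆ i, vecNormTwo (D.col i) with hM
  set P : ℝ := ∑ i, p i with hP
  set ℓ : ℝ := √(Real.log m) with hℓ
  set S : ℝ := ∑ i, p i * vecNormTwo (D.col i) ^ 2 with hS
  set Q : Ω → ℝ := fun ω => (fun i => X i ω) ⬝ᵥ
    ((D * Matrix.diagonal (fun i => ξ i ω) * D) *ᵥ (fun i => X i ω)) with hQ
  have hm1 : (1 : ℝ) < m := by exact_mod_cast hm2
  have hlog : 0 < Real.log m := Real.log_pos hm1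
  have hℓ0 : 0 < ℓ := Real.sqrt_pos.2 hlog
  have hℓ2 : ℓ ^ 2 = Real.log m := Real.sq_sqrt hlog.le
  have hp0 : ∀ k, 0 ≤ p k := fun k => mean_nonneg_of_ae_zero_or_one (h01 k) (hp k)
  have hP0 : 0 ≤ P := Finset.sum_nonneg fun k _ => hp0 k
  have hM1 : ∀ k, vecNormTwo (D.col k) ≤ M := fun k =>
    le_ciSup (f := fun i => vecNormTwo (D.col i)) (Set.finite_range _).bddAbove k
  have hM0 : 0 ≤ M := Real.iSup_nonneg fun k => norm_nonneg _
  have hMd : ∀ k, ∑ j, D j k ^ 2 ≤ M ^ 2 := fun k => by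
    have h : vecNormTwo (D.col k) ^ 2 ≤ M ^ 2 := pow_le_pow_left₀ (norm_nonneg _) (hM1 k) 2
    rw [vecNormTwo_sq] at h
    exact h
  have hSd : S = ∑ i, p i * ∑ j, D j i ^ 2 := by
    simp only [hS, vecNormTwo_sq, Matrix.col_apply]
  have hK2 : 1 ≤ 2 * K ^ 2 :=
    half_le_sq_of_psiTwoNorm_le (hX2 ⟨0, by omega⟩) (hK ⟨0, by omega⟩)
  have hT0 : 0 ≤ T := norm_nonneg _
  have hQm : Measurable Q := (Matrix.measurable_compression_quadForm D).comp
    ((measurable_pi_lambda _ hξ).prodMk (measurable_pi_lambda _ hX))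
  have hQ0 : ∀ᵐ ω ∂μ, 0 ≤ Q ω := by
    filter_upwards [ae_all_iff.2 h01] with ω he
    exact hD.compression_quadForm_nonneg he _
  have habs : ∀ R : ℝ, μ.real {ω | |Q ω| ≤ R} = μ.real {ω | Q ω ≤ R} := fun R =>
    measureReal_congr (hQ0.mono fun ω h => by
      change (|Q ω| ≤ R) = (Q ω ≤ R)
      rw [abs_of_nonneg h])
  rcases hT0.eq_or_lt with hTz | hTpos
  · have hDz : D = 0 := by
      rw [hT, matOpNorm, eq_comm, norm_eq_zero] at hTz
      exact (map_eq_zero_iff _ (Matrix.toEuclideanCLM (n := Fin m) (𝕜 := ℝ)).injective).1 hTz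
    have hS0 : 0 ≤ S := Finset.sum_nonneg fun k _ => mul_nonneg (hp0 k) (sq_nonneg _)
    have huniv : {ω | |Q ω| ≤ S + 1280 * K ^ 2 * ℓ * T * (ℓ * T + 2 * M * √P)} = Set.univ := by
      refine Set.eq_univ_of_forall fun ω => ?_
      simp [hQ, hDz, ← hTz, hS0]
    rw [huniv, probReal_univ]
    have : 0 ≤ 4 / (m : ℝ) ^ 4 := by positivity
    linarith
  set B : ℝ := ℓ * T + M * √P with hB
  have hBpos : 0 < B := by positivity
  have hKpos : 0 < K ^ 2 := by linarith
  have hK0 : K ≠ 0 := fun h => by simp [h] at hKpos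
  -- Here `B ≥ ℓT` gives the admissibility condition `256K²tT² ≤ 1`, and `B ≥ M√P` keeps the
  -- second-order term below `log m`. The case `T = 0` was removed to make `B` positive.
  set t : ℝ := ℓ / (256 * K ^ 2 * T * B) with ht
  have ht0 : 0 ≤ t := by positivity
  have hP2 : √P ^ 2 = P := Real.sq_sqrt hP0
  have htT : 256 * K ^ 2 * t * T ^ 2 ≤ 1 := by
    have : 256 * K ^ 2 * t * T ^ 2 = ℓ * T / B := by rw [ht]; field_simp
    rw [this, div_le_one hBpos, hB]
    have : 0 ≤ M * √P := by positivity
    linarith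
  have hmgf := lintegral_exp_sparse_quadForm_le hX hXi hX1 hK hX2 hξ h01 hξi hp hXξ hD hK2 ht0
    (sq_nonneg T) (mulVec_sq_le_matOpNorm D) hMd htT
  rw [habs]
  refine le_trans ?_ (one_sub_exp_le_measureReal_of_lintegral_exp_le hQm ht0 hmgf)
  rw [← hSd]
  have hexp : t * S + 50000 * K ^ 4 * t ^ 2 * T ^ 2 * M ^ 2 * P
      - t * (S + 1280 * K ^ 2 * ℓ * T * (ℓ * T + 2 * M * √P)) ≤ -(4 * Real.log m) := by
    have e1 : 50000 * K ^ 4 * t ^ 2 * T ^ 2 * M ^ 2 * P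
        = 50000 / 65536 * ℓ ^ 2 * ((M * √P) ^ 2 / B ^ 2) := by
      rw [ht, mul_pow M, hP2]; field_simp; ring
    have e2 : t * (1280 * K ^ 2 * ℓ * T * (ℓ * T + 2 * M * √P))
        = 5 * ℓ ^ 2 * ((ℓ * T + 2 * M * √P) / B) := by
      rw [ht]; field_simp; norm_num
    have hMP : 0 ≤ M * √P := by positivity
    have h1 : (M * √P) ^ 2 / B ^ 2 ≤ 1 := by
      rw [div_le_one (by positivity)]
      apply pow_le_pow_left₀ hMP
      rw [hB]
      have : 0 < ℓ * T := by positivity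
      linarith
    have h2 : 1 ≤ (ℓ * T + 2 * M * √P) / B := by
      rw [one_le_div hBpos, hB]
      linarith
    have h3 : 5 * ℓ ^ 2 * 1 ≤ 5 * ℓ ^ 2 * ((ℓ * T + 2 * M * √P) / B) := by gcongr
    have h4 : 50000 / 65536 * ℓ ^ 2 * ((M * √P) ^ 2 / B ^ 2) ≤ 50000 / 65536 * ℓ ^ 2 * 1 := by
      gcongr
    rw [← hℓ2, mul_add, e1, e2]
    nlinarith [sq_nonneg ℓ]
  have hfin : Real.exp (-(4 * Real.log m)) = 1 / (m : ℝ) ^ 4 := by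
    rw [Real.exp_neg, mul_comm, Real.exp_mul, Real.exp_log (by linarith), one_div]
    norm_cast
  have h5 := (Real.exp_le_exp.2 hexp).trans_eq hfin
  have h6 : 1 / (m : ℝ) ^ 4 ≤ 4 / (m : ℝ) ^ 4 := by gcongr; norm_num
  linarith
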